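/- **Theorem (upper bound to the quantum Fisher information under control).** Consider $N$ qubits with collective spin components $J_a=\tfrac12\sum_{k=1}^N\sigma_a^{(k)}$, $a\in\{x,y,z\}$, subject to classical collective Gaussian dephasing $H_0(s)=J_z\,[b+\xi(s)]$. The noise $\xi$ enters through the accumulated phase $\Lambda(s)=\int_0^s\xi(u)\,\mathrm du$, which is assumed to be a zero-mean Gaussian process (this includes white noise, for which $\Lambda$ is a Brownian motion). Let $0=t_0<t_1<\dots<t_Q<t_{Q+1}=t$, with $Q\ge 0$, let $\theta_1,\dots,\theta_Q\in\mathbb R$, and let $\mathcal O_1,\dots,\mathcal O_Q$ be Hermitian collective operators, i.e. Hermitian elements of the algebra generated by $J_x,J_y,J_z$. The instantaneous pulse $\mathcal U_k=e^{-i\theta_k\mathcal O_k}$ is applied at time $t_k$. Put $$\Delta t_j=t_{j+1}-t_j,\qquad \lambda_j=\int_{t_j}^{t_{j+1}}\xi(s)\,\mathrm ds=\Lambda(t_{j+1})-\Lambda(t_j),\qquad \Sigma_{ij}=\langle\lambda_i\lambda_j\rangle,\qquad 0\le i,j\le Q,$$ and assume that the covariance matrix $\Sigma$ is positive definite. For an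 arbitrary initial density operator $\rho_0$ let the output state be the noise average $$\rho_b(t)=\big\langle U_b(\vec\lambda)\,\rho_0\,U_b(\vec\lambda)^\dagger\big\rangle,\qquad U_b(\vec\lambda)=e^{-iJ_z(b\Delta t_Q+\lambda_Q)}\,\mathcal U_Q\,e^{-iJ_z(b\Delta t_{Q-1}+\lambda_{Q-1})}\cdots\mathcal U_1\,e^{-iJ_z(b\Delta t_0+\lambda_0)} .$$ Then, for every $b\in\mathbb R$, the single-shot quantum Fisher information of $\rho_b(t)$ with respect to $b$ satisfies $$F_Q[\rho_b(t)]\;\le\;\Delta\vec t^{\,\top}\,\Sigma^{-1}\,\Delta\vec t .$$ Here $F_Q[\rho_b]=\mathrm{Tr}[\rho_bL^2]$, where $L$ is a symmetric logarithmic derivative, i.e. a Hermitian operator with $\partial_b\rho_b=\tfrac12(L\rho_b+\rho_bL)$; in particular $\rho_b(t)$ is differentiable in $b$ and such an $L$ exists. -/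

import Mathlib

open MeasureTheory ProbabilityTheory Matrix
open scoped ENNReal NNReal ComplexOrder

namespace DephasingMetrology

/-! ### Collective spin of `N` qubits -/

/-- Operators on the Hilbert space `(ℂ²)^{⊗N}` of `N` qubits, as matrices in the computational
basis, whose elements are the configurations `Fin N → Fin 2`. -/
abbrev Op (N : ℕ) : Type := Matrix (Fin N → Fin 2) (Fin N → Fin 2) ℂ

/-- The Pauli matrix `σ_x`. -/
def pauliX : Matrix (Fin 2) (Fin 2) ℂ := !![0, 1; 1, 0]

/-- The Pauli matrix `σ_y`. -/
def pauliY : Matrix (Fin 2) (Fin 2) ℂ := !![0, -Complex.I; Complex.I, 0]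

/-- The Pauli matrix `σ_z`. -/
def pauliZ : Matrix (Fin 2) (Fin 2) ℂ := !![1, 0; 0, -1]

/-- The operator acting as `A` on the `k`-th qubit and as the identity on all the other ones,
`1 ⊗ ⋯ ⊗ A ⊗ ⋯ ⊗ 1`. -/
def onQubit {N : ℕ} (k : Fin N) (A : Matrix (Fin 2) (Fin 2) ℂ) : Op N :=
  Matrix.of fun x y => if ∀ l, l ≠ k → x l = y l then A (x k) (y k) else 0

/-- The collective operator `½ ∑ₖ A⁽ᵏ⁾`. -/
noncomputable def collectiveSpin (N : ℕ) (A : Matrix (Fin 2) (Fin 2) ℂ) : Op N :=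
  (1 / 2 : ℂ) • ∑ k : Fin N, onQubit k A

/-- The collective spin component `J_x`. -/
noncomputable def Jx (N : ℕ) : Op N := collectiveSpin N pauliX

/-- The collective spin component `J_y`. -/
noncomputable def Jy (N : ℕ) : Op N := collectiveSpin N pauliY

/-- The collective spin component `J_z`. -/
noncomputable def Jz (N : ℕ) : Op N := collectiveSpin N pauliZ

/-- A collective operator: an arbitrary function (noncommutative polynomial) of the spin components
`J_x`, `J_y`, `J_z`. -/
def IsCollective {N : ℕ} (O : Op N) : Prop :=
  O ∈ Algebra.adjoin ℂ ({Jx N, Jy N, Jz N} : Set (Op N))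

/-- Density operators. -/
def IsDensity {N : ℕ} (ρ : Op N) : Prop := ρ.PosSemidef ∧ ρ.trace = 1

/-! ### Segmentation and noise phases

`t 0 = 0 < t 1 < ⋯ < t Q < t (Q + 1)`: the pulses act at the interior times, and the last time is
the encoding (interrogation) time. `Λ s` is the noise phase accumulated up to time `s`, i.e. the
integral of the noise `ξ` over `[0, s]`. Taking `Λ` as the primary object also covers
white noise, for which only the integral of `ξ` is an honest stochastic process. -/

/-- The lengths `Δtⱼ = tⱼ₊₁ - tⱼ` of the free-evolution segments. -/
def segmentLength {Q : ℕ} (t : Fin (Q + 2) → ℝ≥0) (j : Fin (Q + 1)) : ℝ :=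
  (t j.succ : ℝ) - (t j.castSucc : ℝ)

/-- The random phases `λⱼ`, the integral of the noise over `[tⱼ, tⱼ₊₁]`. -/
def segmentPhase {Ω : Type*} {Q : ℕ} (Λ : ℝ≥0 → Ω → ℝ) (t : Fin (Q + 2) → ℝ≥0)
    (j : Fin (Q + 1)) (ω : Ω) : ℝ :=
  Λ (t j.succ) ω - Λ (t j.castSucc) ω

/-- The covariance matrix `Σᵢⱼ = ⟨λᵢ λⱼ⟩` of the (zero-mean) segment phases. -/
noncomputable def phaseCovariance {Ω : Type*} [MeasurableSpace Ω] (P : Measure Ω) {Q : ℕ}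
    (Λ : ℝ≥0 → Ω → ℝ) (t : Fin (Q + 2) → ℝ≥0) : Matrix (Fin (Q + 1)) (Fin (Q + 1)) ℝ :=
  Matrix.of fun i j => ∫ ω, segmentPhase Λ t i ω * segmentPhase Λ t j ω ∂P

/-! ### Controlled dynamics -/

/-- The unitary `exp (-i φ A)`. -/
noncomputable def evolve {N : ℕ} (A : Op N) (φ : ℝ) : Op N :=
  NormedSpace.exp ((-Complex.I * (φ : ℂ)) • A)

/-- The propagator with total phase `φⱼ` acquired in the `j`-th free segment: the time-ordered
product (later times to the left)
`e^{-i φ_Q J_z} · e^{-i θ_{Q-1} O_{Q-1}} e^{-i φ_{Q-1} J_z} ⋯ e^{-i θ₀ O₀} e^{-i φ₀ J_z}`,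
where the `k`-th instantaneous pulse (`k = 0, …, Q - 1`) ends the `k`-th segment. -/
noncomputable def propagator {N Q : ℕ} (θ : Fin Q → ℝ) (O : Fin Q → Op N)
    (φ : Fin (Q + 1) → ℝ) : Op N :=
  evolve (Jz N) (φ (Fin.last Q)) *
    (List.ofFn fun k : Fin Q =>
      evolve (O k.rev) (θ k.rev) * evolve (Jz N) (φ k.rev.castSucc)).prod

/-- The noise-averaged output state
`ρ_b = ⟨U ρ₀ U†⟩`, where in each noise realization `U` is the propagator with segment phases
`b Δtⱼ + λⱼ`. -/
noncomputable def outputState {Ω : Type*} [MeasurableSpace Ω] (P : Measure Ω) {N Q : ℕ}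
    (Λ : ℝ≥0 → Ω → ℝ) (t : Fin (Q + 2) → ℝ≥0) (θ : Fin Q → ℝ) (O : Fin Q → Op N)
    (ρ₀ : Op N) (b : ℝ) : Op N :=
  Matrix.of fun x y => ∫ ω,
    (propagator θ O (fun j => b * segmentLength t j + segmentPhase Λ t j ω) * ρ₀ *
      (propagator θ O (fun j => b * segmentLength t j + segmentPhase Λ t j ω))ᴴ) x y ∂P

/-! ### Quantum Fisher information -/

/-- `L` is a symmetric logarithmic derivative of the curve `ρ` at `b`: it is Hermitian, and `ρ` is
differentiable at `b` with derivative `½ (L ρ_b + ρ_b L)`. -/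
def IsSLD {N : ℕ} (ρ : ℝ → Op N) (b : ℝ) (L : Op N) : Prop :=
  L.IsHermitian ∧
    ∀ x y, HasDerivAt (fun s => ρ s x y) (((1 / 2 : ℂ) • (L * ρ b + ρ b * L)) x y) b

/-- The quantum Fisher information `Tr (ρ_b L²)` of the curve of states `ρ` at `b`, where `L` is a
symmetric logarithmic derivative. The value is the same for every such `L`, so that the infimum only
serves to select it; it is `∞` when there is no symmetric logarithmic derivative. -/
noncomputable def quantumFisherInformation {N : ℕ} (ρ : ℝ → Op N) (b : ℝ) : ℝ≥0∞ :=
  ⨅ (L : Op N) (_ : IsSLD ρ b L), ENNReal.ofReal (ρ b * (L * L)).trace.re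

end DephasingMetrology

/-! In each noise realization the state `V` depends on `b` and the noise only through the vector of
total phases `b Δt + λ`. So `ρ_b` is a mixture of fixed states, with mixing law the Gaussian of mean
`b Δt` and covariance `Σ`. Mixing cannot create information: the quantum Fisher information is at
most the classical one of that Gaussian shift family, `Δtᵀ Σ⁻¹ Δt`.

No densities are needed. With `Σ c = Δt` the score is `s = c ⬝ λ`, and `∂_b ρ_b = ⟨s V⟩` follows
from Stein's identity (`IsCentredGaussianVector.hasDerivAt_integral_shift`), because the entries of
`V` are trigonometric polynomials in the phases: `J_z` is diagonal and the pulses are constant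
matrices. Monotonicity (`exists_lyapunov_trace_le`) comes from `⟨Tr (s - L) V (s - L)⟩ ≥ 0`, which
expands to `⟨s²⟩ - 2F + F ≥ 0`; finally `⟨s²⟩ = cᵀ Σ c = Δtᵀ Σ⁻¹ Δt`. The operator `L` exists
because a vector killed by the mean of `V` is killed by almost every `V`, hence by `⟨s V⟩`. -/

namespace DephasingMetrology

/-! ### Existence of symmetric logarithmic derivatives -/

/-- The Lyapunov equation `½ (L ρ + ρ L) = D` has a Hermitian solution when `D` is Hermitian and
vanishes on the kernel of the positive semidefinite `ρ`. -/
theorem exists_isHermitian_lyapunov {n : Type*} [Fintype n] [DecidableEq n]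
    {ρ D : Matrix n n ℂ} (hρ : ρ.PosSemidef) (hD : D.IsHermitian)
    (hker : ∀ v : n → ℂ, ρ *ᵥ v = 0 → D *ᵥ v = 0) :
    ∃ L : Matrix n n ℂ, L.IsHermitian ∧ (1 / 2 : ℂ) • (L * ρ + ρ * L) = D := by
  set W : Matrix n n ℂ := hρ.isHermitian.eigenvectorUnitary.1 with hW
  set p : n → ℝ := hρ.isHermitian.eigenvalues with hp
  have hp0 : ∀ i, 0 ≤ p i := hρ.eigenvalues_nonneg
  have hWW : Wᴴ * W = 1 := Unitary.coe_star_mul_self hρ.isHermitian.eigenvectorUnitary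
  have hWW' : W * Wᴴ = 1 := Unitary.coe_mul_star_self hρ.isHermitian.eigenvectorUnitary
  have hspec : ρ = W * diagonal (fun i => (p i : ℂ)) * Wᴴ := hρ.isHermitian.spectral_theorem
  set D' : Matrix n n ℂ := Wᴴ * D * W with hD'
  have hD'h : D'.IsHermitian := isHermitian_conjTranspose_mul_mul W hD
  -- The kernel hypothesis read in the eigenbasis of `ρ`.
  have hcol : ∀ i, p i = 0 → ∀ j, D' j i = 0 := by
    intro i hi j
    have h1 : ρ *ᵥ (W *ᵥ Pi.single i 1) = 0 := by
      rw [hspec, mulVec_mulVec, Matrix.mul_assoc, hWW, Matrix.mul_one, ← mulVec_mulVec]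
      have : diagonal (fun i => (p i : ℂ)) *ᵥ Pi.single i 1 = 0 := by
        ext k
        by_cases hk : k = i
        · subst hk; simp [mulVec_diagonal, hi]
        · simp [mulVec_diagonal, hk]
      rw [this, mulVec_zero]
    have h2 : D' *ᵥ Pi.single i 1 = 0 := by
      rw [hD', ← mulVec_mulVec, ← mulVec_mulVec, hker _ h1, mulVec_zero]
    simpa using congrFun h2 j
  -- In the eigenbasis the equation decouples into `(p i + p j) L' i j / 2 = D' i j`. If both
  -- eigenvalues vanish, division by zero gives the entry `0`, which is consistent by `hcol`.
  set L' : Matrix n n ℂ := Matrix.of fun i j => 2 * D' i j / ((p i : ℂ) + p j) with hL'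
  have hL'h : L'.IsHermitian := by
    ext i j
    have := hD'h.apply i j
    simp only [hL', conjTranspose_apply, of_apply, star_div₀, star_mul', star_add, this]
    simp [add_comm]
  have hL'eq : (1 / 2 : ℂ) • (L' * diagonal (fun i => (p i : ℂ)) +
      diagonal (fun i => (p i : ℂ)) * L') = D' := by
    ext i j
    simp only [Matrix.smul_apply, Matrix.add_apply, mul_diagonal, diagonal_mul, hL',
      of_apply, smul_eq_mul]
    by_cases h : p i + p j = 0
    · have hj : p j = 0 := by linarith [hp0 i, hp0 j]
      have hi : p i = 0 := by linarith [hp0 i, hp0 j]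
      simp [hi, hj, hcol j hj i]
    · have h' : (p i : ℂ) + p j ≠ 0 := by exact_mod_cast h
      field_simp
      ring
  refine ⟨W * L' * Wᴴ, isHermitian_mul_mul_conjTranspose W hL'h, ?_⟩
  have e1 : W * L' * Wᴴ * ρ = W * (L' * diagonal (fun i => (p i : ℂ))) * Wᴴ := by
    rw [hspec]
    calc _ = W * L' * (Wᴴ * W) * diagonal (fun i => (p i : ℂ)) * Wᴴ := by
          simp only [Matrix.mul_assoc]
      _ = _ := by rw [hWW, Matrix.mul_one]; simp only [Matrix.mul_assoc]
  have e2 : ρ * (W * L' * Wᴴ) = W * (diagonal (fun i => (p i : ℂ)) * L') * Wᴴ := by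
    rw [hspec]
    calc _ = W * diagonal (fun i => (p i : ℂ)) * (Wᴴ * W) * L' * Wᴴ := by
          simp only [Matrix.mul_assoc]
      _ = _ := by rw [hWW, Matrix.mul_one]; simp only [Matrix.mul_assoc]
  rw [e1, e2, ← Matrix.add_mul, ← Matrix.mul_add, ← Matrix.smul_mul, ← Matrix.mul_smul, hL'eq, hD']
  calc _ = (W * Wᴴ) * D * (W * Wᴴ) := by simp only [Matrix.mul_assoc]
    _ = D := by rw [hWW', Matrix.one_mul, Matrix.mul_one]

/-! ### Averages of random matrices -/

/-- The entrywise expectation of a random matrix. -/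
noncomputable def matrixMean {Ω : Type*} [MeasurableSpace Ω] {n : Type*} (P : Measure Ω)
    (V : Ω → Matrix n n ℂ) : Matrix n n ℂ :=
  Matrix.of fun x y => ∫ ω, V ω x y ∂P

section

variable {Ω : Type*} [MeasurableSpace Ω] {P : Measure Ω} {n : Type*} [Fintype n]
  {V : Ω → Matrix n n ℂ}

theorem integrable_trace_mul (hV : ∀ x y, Integrable (fun ω => V ω x y) P) (M : Matrix n n ℂ) :
    Integrable (fun ω => (V ω * M).trace) P := by
  simp only [trace, diag_apply, mul_apply]
  exact integrable_finsetSum _ fun i _ => integrable_finsetSum _ fun j _ => (hV i j).mul_const _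

theorem trace_matrixMean_mul (hV : ∀ x y, Integrable (fun ω => V ω x y) P) (M : Matrix n n ℂ) :
    (matrixMean P V * M).trace = ∫ ω, (V ω * M).trace ∂P := by
  simp only [trace, diag_apply, mul_apply, matrixMean, of_apply]
  rw [integral_finsetSum _ fun i _ => integrable_finsetSum _ fun j _ => (hV i j).mul_const _]
  refine Finset.sum_congr rfl fun i _ => ?_
  rw [integral_finsetSum _ fun j _ => (hV i j).mul_const _]
  exact Finset.sum_congr rfl fun j _ => (integral_mul_const _ _).symm

theorem matrixMean_mulVec (hV : ∀ x y, Integrable (fun ω => V ω x y) P) (v : n → ℂ) (i : n) :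
    (matrixMean P V *ᵥ v) i = ∫ ω, (V ω *ᵥ v) i ∂P := by
  simp only [mulVec, dotProduct, matrixMean, of_apply]
  rw [integral_finsetSum _ fun j _ => (hV i j).mul_const _]
  exact Finset.sum_congr rfl fun j _ => (integral_mul_const _ _).symm

theorem integrable_mulVec (hV : ∀ x y, Integrable (fun ω => V ω x y) P) (v : n → ℂ) (i : n) :
    Integrable (fun ω => (V ω *ᵥ v) i) P := by
  simp only [mulVec, dotProduct]
  exact integrable_finsetSum _ fun j _ => (hV i j).mul_const _

theorem integrable_dotProduct_mulVec (hV : ∀ x y, Integrable (fun ω => V ω x y) P)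
    (v w : n → ℂ) : Integrable (fun ω => w ⬝ᵥ (V ω *ᵥ v)) P := by
  simp only [dotProduct]
  exact integrable_finsetSum _ fun i _ => (integrable_mulVec hV v i).const_mul _

theorem dotProduct_matrixMean_mulVec (hV : ∀ x y, Integrable (fun ω => V ω x y) P)
    (v w : n → ℂ) : w ⬝ᵥ (matrixMean P V *ᵥ v) = ∫ ω, w ⬝ᵥ (V ω *ᵥ v) ∂P := by
  simp only [dotProduct]
  rw [integral_finsetSum _ fun i _ => (integrable_mulVec hV v i).const_mul _]
  refine Finset.sum_congr rfl fun i _ => ?_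
  rw [matrixMean_mulVec hV, integral_const_mul]

omit [Fintype n] in
theorem isHermitian_matrixMean (hV : ∀ ω, (V ω).IsHermitian) : (matrixMean P V).IsHermitian := by
  ext x y
  simp only [matrixMean, conjTranspose_apply, of_apply]
  change (starRingEnd ℂ) (∫ ω, V ω y x ∂P) = _
  rw [← integral_conj]
  exact integral_congr_ae (.of_forall fun ω => (hV ω).apply x y)

theorem posSemidef_matrixMean (hVi : ∀ x y, Integrable (fun ω => V ω x y) P)
    (hV : ∀ ω, (V ω).PosSemidef) : (matrixMean P V).PosSemidef := by
  refine PosSemidef.of_dotProduct_mulVec_nonneg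
    (isHermitian_matrixMean fun ω => (hV ω).isHermitian) fun v => ?_
  rw [dotProduct_matrixMean_mulVec hVi]
  exact integral_nonneg fun ω => (hV ω).dotProduct_mulVec_nonneg v

/-- The nonnegative quadratic form of `V ω` at `v` has mean zero, so it vanishes almost surely; for
a positive semidefinite matrix this forces `v` into the kernel. -/
theorem ae_mulVec_eq_zero_of_matrixMean (hVi : ∀ x y, Integrable (fun ω => V ω x y) P)
    (hV : ∀ ω, (V ω).PosSemidef) {v : n → ℂ} (hv : matrixMean P V *ᵥ v = 0) :
    ∀ᵐ ω ∂P, V ω *ᵥ v = 0 := by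
  have h0 : ∫ ω, star v ⬝ᵥ (V ω *ᵥ v) ∂P = 0 := by
    rw [← dotProduct_matrixMean_mulVec hVi, hv, dotProduct_zero]
  have hre : ∫ ω, (star v ⬝ᵥ (V ω *ᵥ v)).re ∂P = 0 := by
    have := integral_re (𝕜 := ℂ) (integrable_dotProduct_mulVec hVi v (star v))
    rw [h0] at this
    simpa using this
  have hnn : ∀ ω, 0 ≤ star v ⬝ᵥ (V ω *ᵥ v) := fun ω => (hV ω).dotProduct_mulVec_nonneg v
  rw [integral_eq_zero_iff_of_nonneg (fun ω => (Complex.le_def.1 (hnn ω)).1)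
    (integrable_dotProduct_mulVec hVi v (star v)).re] at hre
  filter_upwards [hre] with ω hω
  rw [← (hV ω).dotProduct_mulVec_zero_iff]
  exact Complex.ext hω (Complex.le_def.1 (hnn ω)).2.symm

/-- Monotonicity of the Fisher information: if the derivative of a mixture of states `V` is the mean
of `s V` with a classical score `s`, then there is a symmetric logarithmic derivative, whose
Fisher information is at most the second moment of the score. -/
theorem exists_lyapunov_trace_le [DecidableEq n]
    (hVi : ∀ x y, Integrable (fun ω => V ω x y) P)
    (hV : ∀ ω, (V ω).PosSemidef) (hV1 : ∀ ω, (V ω).trace = 1) {s : Ω → ℝ}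
    (hsV : ∀ x y, Integrable (fun ω => (s ω • V ω) x y) P)
    (hs : Integrable (fun ω => s ω ^ 2) P) :
    ∃ L : Matrix n n ℂ, L.IsHermitian ∧
      (1 / 2 : ℂ) • (L * matrixMean P V + matrixMean P V * L) =
        matrixMean P (fun ω => s ω • V ω) ∧
      (matrixMean P V * (L * L)).trace.re ≤ ∫ ω, s ω ^ 2 ∂P := by
  have hker : ∀ v : n → ℂ, matrixMean P V *ᵥ v = 0 →
      matrixMean P (fun ω => s ω • V ω) *ᵥ v = 0 := by
    intro v hv
    ext i
    rw [matrixMean_mulVec hsV]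
    refine integral_eq_zero_of_ae ?_
    filter_upwards [ae_mulVec_eq_zero_of_matrixMean hVi hV hv] with ω hω
    simp [smul_mulVec, hω]
  obtain ⟨L, hL, hLeq⟩ := exists_isHermitian_lyapunov (posSemidef_matrixMean hVi hV)
    (isHermitian_matrixMean fun ω => (hV ω).isHermitian.smul (IsSelfAdjoint.all (s ω))) hker
  refine ⟨L, hL, hLeq, ?_⟩
  set F := (matrixMean P V * (L * L)).trace with hF
  -- By cyclicity of the trace, both halves of the symmetrized product contribute `F / 2`.
  have hcross : (matrixMean P (fun ω => s ω • V ω) * L).trace = F := by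
    rw [← hLeq, smul_mul, trace_smul, Matrix.add_mul, trace_add, hF, Matrix.mul_assoc L,
      trace_mul_comm L, Matrix.mul_assoc, smul_eq_mul]
    ring
  -- This is the trace of the positive matrix `(s - L) V (s - L)`, expanded using `Tr V = 1`.
  have hpt : ∀ ω, 0 ≤ s ω ^ 2 - 2 * ((s ω • V ω) * L).trace.re + (V ω * (L * L)).trace.re := by
    intro ω
    have hM : ((s ω : ℂ) • (1 : Matrix n n ℂ) - L).IsHermitian :=
      IsHermitian.sub (by simp [IsHermitian, conjTranspose_smul]) hL
    have h := ((hV ω).mul_mul_conjTranspose_same ((s ω : ℂ) • (1 : Matrix n n ℂ) - L)).trace_nonneg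
    rw [hM.eq] at h
    have e : (((s ω : ℂ) • (1 : Matrix n n ℂ) - L) * V ω * ((s ω : ℂ) • (1 : Matrix n n ℂ) - L)).trace
        = (s ω : ℂ) ^ 2 - 2 * ((s ω • V ω) * L).trace + (V ω * (L * L)).trace := by
      rw [Matrix.mul_assoc, trace_mul_comm, Matrix.mul_assoc]
      have : (s ω • V ω) = (s ω : ℂ) • V ω := by ext; simp
      rw [this]
      simp only [sub_mul, mul_sub, Matrix.smul_mul, Matrix.mul_smul, Matrix.one_mul,
        Matrix.mul_one, trace_sub, trace_smul, hV1, smul_eq_mul]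
      ring
    rw [e] at h
    have := (Complex.le_def.1 h).1
    simpa [← Complex.ofReal_pow] using this
  have hint := integral_nonneg_of_ae (μ := P) (.of_forall hpt)
  have i1 := (integrable_trace_mul hsV L)
  have i2 := (integrable_trace_mul hVi (L * L))
  have i1r : Integrable (fun ω => ((s ω • V ω) * L).trace.re) P := i1.re
  have i2r : Integrable (fun ω => (V ω * (L * L)).trace.re) P := i2.re
  have r1 : ∫ ω, ((s ω • V ω) * L).trace.re ∂P = F.re := by
    rw [← hcross, trace_matrixMean_mul hsV]; exact integral_re i1
  have r2 : ∫ ω, (V ω * (L * L)).trace.re ∂P = F.re := by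
    rw [hF, trace_matrixMean_mul hVi]; exact integral_re i2
  have i3 : Integrable (fun ω => s ω ^ 2 - 2 * ((s ω • V ω) * L).trace.re) P :=
    hs.sub (i1r.const_mul 2)
  rw [integral_add i3 i2r, integral_sub hs (i1r.const_mul 2), integral_const_mul, r1, r2] at hint
  linarith

end

/-! ### Gaussian vectors and their characters -/

section

variable {Ω : Type*} [MeasurableSpace Ω] {P : Measure Ω} {m : ℕ}

/-- A finite family of real random variables all of whose linear combinations are centred Gaussian,
with covariance matrix `C`. -/
structure IsCentredGaussianVector (P : Measure Ω) (X : Fin m → Ω → ℝ)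
    (C : Matrix (Fin m) (Fin m) ℝ) : Prop where
  hasGaussianLaw : ∀ u : Fin m → ℝ, HasGaussianLaw (fun ω => ∑ j, u j * X j ω) P
  integral_eq_zero : ∀ u : Fin m → ℝ, ∫ ω, ∑ j, u j * X j ω ∂P = 0
  integral_mul : ∀ u v : Fin m → ℝ,
    ∫ ω, (∑ j, u j * X j ω) * (∑ j, v j * X j ω) ∂P = u ⬝ᵥ (C *ᵥ v)

variable {X : Fin m → Ω → ℝ} {C : Matrix (Fin m) (Fin m) ℝ}

namespace IsCentredGaussianVector

/-- The complex moment generating function of the Gaussian `u ⬝ X`, evaluated at `Complex.I`. -/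
theorem integral_cexp (hX : IsCentredGaussianVector P X C) (u : Fin m → ℝ) :
    ∫ ω, Complex.exp (Complex.I * ((∑ j, u j * X j ω : ℝ) : ℂ)) ∂P =
      Complex.exp (-(1 / 2) * ((u ⬝ᵥ (C *ᵥ u) : ℝ) : ℂ)) := by
  have hg := hX.hasGaussianLaw u
  have := hg.isProbabilityMeasure
  have h := complexMGF_gaussianReal hg.map_eq_gaussianReal Complex.I
  have hv : Var[fun ω => ∑ j, u j * X j ω; P] = u ⬝ᵥ (C *ᵥ u) := by
    rw [variance_of_integral_eq_zero hg.aemeasurable (hX.integral_eq_zero u), ← hX.integral_mul u u]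
    simp only [sq]
  rw [hX.integral_eq_zero u] at h
  rw [complexMGF] at h
  rw [h]
  congr 1
  have : ((Var[fun ω => ∑ j, u j * X j ω; P].toNNReal : ℝ) : ℂ) = ((u ⬝ᵥ (C *ᵥ u) : ℝ) : ℂ) := by
    rw [Real.coe_toNNReal _ (variance_nonneg _ _), hv]
  rw [this, Complex.I_sq]
  push_cast
  ring

theorem integrable_mul_cexp (hX : IsCentredGaussianVector P X C) (u c : Fin m → ℝ) :
    Integrable (fun ω => ((∑ j, c j * X j ω : ℝ) : ℂ) *
      Complex.exp (Complex.I * ((∑ j, u j * X j ω : ℝ) : ℂ))) P := by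
  refine (hX.hasGaussianLaw c).integrable.ofReal.mul_bdd (c := 1) ?_ ?_
  · have := (hX.hasGaussianLaw u).aemeasurable
    exact (by fun_prop : AEMeasurable (fun ω =>
      Complex.exp (Complex.I * ((∑ j, u j * X j ω : ℝ) : ℂ))) P).aestronglyMeasurable
  · exact .of_forall fun ω => (by rw [mul_comm, Complex.norm_exp_ofReal_mul_I])

theorem integrable_cexp (hX : IsCentredGaussianVector P X C) (u : Fin m → ℝ) :
    Integrable (fun ω => Complex.exp (Complex.I * ((∑ j, u j * X j ω : ℝ) : ℂ))) P := by
  have := (hX.hasGaussianLaw u).isProbabilityMeasure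
  have h := (hX.hasGaussianLaw u).aemeasurable
  refine Integrable.of_bound (by fun_prop : AEMeasurable (fun ω =>
      Complex.exp (Complex.I * ((∑ j, u j * X j ω : ℝ) : ℂ))) P).aestronglyMeasurable 1 ?_
  exact .of_forall fun ω => (by rw [mul_comm, Complex.norm_exp_ofReal_mul_I])

/-- Stein's identity for the characters of a Gaussian vector. -/
theorem integral_mul_cexp (hX : IsCentredGaussianVector P X C) (hC : C.IsSymm)
    (u c : Fin m → ℝ) :
    ∫ ω, ((∑ j, c j * X j ω : ℝ) : ℂ) *
        Complex.exp (Complex.I * ((∑ j, u j * X j ω : ℝ) : ℂ)) ∂P =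
      Complex.I * ((u ⬝ᵥ (C *ᵥ c) : ℝ) : ℂ) *
        Complex.exp (-(1 / 2) * ((u ⬝ᵥ (C *ᵥ u) : ℝ) : ℂ)) := by
  have hsum : ∀ (τ : ℝ) ω, (∑ j, (u + τ • c) j * X j ω) =
      (∑ j, u j * X j ω) + τ * ∑ j, c j * X j ω := by
    intro τ ω
    simp only [Pi.add_apply, Pi.smul_apply, smul_eq_mul, add_mul, Finset.sum_add_distrib,
      Finset.mul_sum, mul_assoc]
  set F : ℝ → Ω → ℂ := fun τ ω =>
    Complex.exp (Complex.I * ((∑ j, (u + τ • c) j * X j ω : ℝ) : ℂ)) with hF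
  set F' : ℝ → Ω → ℂ := fun τ ω => Complex.I * (((∑ j, c j * X j ω : ℝ) : ℂ) *
    Complex.exp (Complex.I * ((∑ j, (u + τ • c) j * X j ω : ℝ) : ℂ))) with hF'
  -- The characteristic function is differentiated at `u` in direction `c`. Characters have modulus
  -- one, so `|c ⬝ X|` dominates the derivative for every `τ`.
  have key := (hasDerivAt_integral_of_dominated_loc_of_deriv_le (μ := P) (F := F) (F' := F')
    (x₀ := (0 : ℝ)) (s := Set.univ) (bound := fun ω => ‖(∑ j, c j * X j ω : ℝ)‖)
    Filter.univ_mem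
    (.of_forall fun τ => (hX.integrable_cexp (u + τ • c)).aestronglyMeasurable)
    (hX.integrable_cexp _)
    ((hX.integrable_mul_cexp (u + (0 : ℝ) • c) c).const_mul Complex.I).aestronglyMeasurable
    (.of_forall fun ω τ _ => by
      simp only [hF']
      rw [norm_mul, norm_mul, mul_comm Complex.I (Complex.ofReal _),
        Complex.norm_exp_ofReal_mul_I, Complex.norm_I, Complex.norm_real, one_mul, mul_one])
    (hX.hasGaussianLaw c).integrable.norm
    (.of_forall fun ω τ _ => by
      simp only [hF, hF', hsum]
      have h1 : HasDerivAt (fun τ : ℝ => (((∑ j, u j * X j ω) + τ * ∑ j, c j * X j ω : ℝ) : ℂ))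
          ((∑ j, c j * X j ω : ℝ) : ℂ) τ := by
        have := (((hasDerivAt_id τ).mul_const (∑ j, c j * X j ω)).const_add
          (∑ j, u j * X j ω)).ofReal_comp
        simpa using this
      exact (h1.const_mul Complex.I).cexp.congr_deriv (by ring))).2
  have hq : ∀ τ : ℝ, (u + τ • c) ⬝ᵥ (C *ᵥ (u + τ • c)) =
      u ⬝ᵥ (C *ᵥ u) + 2 * τ * (u ⬝ᵥ (C *ᵥ c)) + τ ^ 2 * (c ⬝ᵥ (C *ᵥ c)) := by
    intro τ
    have hsymm : c ⬝ᵥ (C *ᵥ u) = u ⬝ᵥ (C *ᵥ c) := by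
      rw [dotProduct_mulVec, dotProduct_comm, ← mulVec_transpose, hC.eq]
    simp only [mulVec_add, mulVec_smul, dotProduct_add, add_dotProduct, smul_dotProduct,
      dotProduct_smul, smul_eq_mul, hsymm]
    ring
  have hval : ∀ τ : ℝ, ∫ ω, F τ ω ∂P = Complex.exp (-(1 / 2) * ((u ⬝ᵥ (C *ᵥ u) +
      2 * τ * (u ⬝ᵥ (C *ᵥ c)) + τ ^ 2 * (c ⬝ᵥ (C *ᵥ c)) : ℝ) : ℂ)) := by
    intro τ
    rw [← hq, ← hX.integral_cexp]
  simp only [hval] at key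
  have hr : HasDerivAt (fun τ : ℝ => (u ⬝ᵥ (C *ᵥ u) +
      2 * τ * (u ⬝ᵥ (C *ᵥ c)) + τ ^ 2 * (c ⬝ᵥ (C *ᵥ c)) : ℝ)) (2 * (u ⬝ᵥ (C *ᵥ c))) 0 := by
    have h1 := (((hasDerivAt_id (0 : ℝ)).const_mul 2).mul_const (u ⬝ᵥ (C *ᵥ c))).const_add
      (u ⬝ᵥ (C *ᵥ u))
    have h2 := ((hasDerivAt_id (0 : ℝ)).pow 2).mul_const (c ⬝ᵥ (C *ᵥ c))
    exact (h1.add h2).congr_deriv (by simp)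
  have heq := key.unique ((hr.ofReal_comp.const_mul (-(1 / 2))).cexp)
  simp only [hF', integral_const_mul, zero_smul, add_zero] at heq
  have hI : Complex.I * Complex.I = -1 := Complex.I_mul_I
  have := congrArg (fun z => -Complex.I * z) heq
  simp only [← mul_assoc, neg_mul, hI, neg_neg, one_mul] at this
  rw [this]
  push_cast
  simp
  ring

end IsCentredGaussianVector

/-- Joint Gaussianity of the phases holds since each linear combination is a linear functional of
`Λ` restricted to the finite set of times `t i`. -/
theorem isCentredGaussianVector_segmentPhase {Q : ℕ} {Λ : ℝ≥0 → Ω → ℝ}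
    (hΛ : IsGaussianProcess Λ P) (hΛ0 : ∀ s, ∫ ω, Λ s ω ∂P = 0) (t : Fin (Q + 2) → ℝ≥0) :
    IsCentredGaussianVector P (segmentPhase Λ t) (phaseCovariance P Λ t) := by
  have hseg : ∀ j, HasGaussianLaw (segmentPhase Λ t j) P := fun j => hΛ.hasGaussianLaw_fun_sub
  refine ⟨fun u => ?_, fun u => ?_, fun u v => ?_⟩
  · classical
    let I : Finset ℝ≥0 := Finset.univ.image t
    have hI : ∀ i, t i ∈ I := fun i => Finset.mem_image_of_mem _ (Finset.mem_univ i)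
    let pr : ∀ i, (I → ℝ) →L[ℝ] ℝ := fun i => ContinuousLinearMap.proj ⟨t i, hI i⟩
    have := (hΛ.hasGaussianLaw I).map_fun (∑ j, u j • (pr j.succ - pr j.castSucc))
    have e : (fun ω => ∑ j, u j * segmentPhase Λ t j ω) = fun ω =>
        (∑ j, u j • (pr j.succ - pr j.castSucc)) (I.restrict (Λ · ω)) := by
      funext ω
      simp [pr, segmentPhase]
    rw [e]
    exact this
  · rw [integral_finsetSum _ fun j _ => (hseg j).integrable.const_mul _]
    refine Finset.sum_eq_zero fun j _ => ?_
    rw [integral_const_mul]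
    simp only [segmentPhase]
    rw [integral_sub (hΛ.hasGaussianLaw_eval _).integrable (hΛ.hasGaussianLaw_eval _).integrable,
      hΛ0, hΛ0, sub_zero, mul_zero]
  · have hint : ∀ i j, Integrable (fun ω => segmentPhase Λ t i ω * segmentPhase Λ t j ω) P :=
      fun i j => (hseg i).memLp_two.integrable_mul (hseg j).memLp_two
    have e : ∀ ω, (∑ j, u j * segmentPhase Λ t j ω) * (∑ j, v j * segmentPhase Λ t j ω) =
        ∑ i, ∑ j, u i * v j * (segmentPhase Λ t i ω * segmentPhase Λ t j ω) := by
      intro ω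
      rw [Finset.sum_mul_sum]
      exact Finset.sum_congr rfl fun i _ => Finset.sum_congr rfl fun j _ => by ring
    simp only [e]
    rw [integral_finsetSum _ fun i _ => integrable_finsetSum _ fun j _ => (hint i j).const_mul _]
    simp only [dotProduct, mulVec, phaseCovariance, of_apply, Finset.mul_sum]
    refine Finset.sum_congr rfl fun i _ => ?_
    rw [integral_finsetSum _ fun j _ => (hint i j).const_mul _]
    refine Finset.sum_congr rfl fun j _ => ?_
    rw [integral_const_mul]
    ring

end

/-! ### Trigonometric polynomials -/

/-- The character `φ ↦ exp (i u ⬝ φ)`. -/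
noncomputable def character {m : ℕ} (u : Fin m → ℝ) : (Fin m → ℝ) → ℂ :=
  fun φ => Complex.exp (Complex.I * ((∑ j, u j * φ j : ℝ) : ℂ))

/-- The algebra of trigonometric polynomials in `m` real variables. -/
noncomputable def trigPolynomials (m : ℕ) : Subalgebra ℂ ((Fin m → ℝ) → ℂ) :=
  Algebra.adjoin ℂ (Set.range character)

section

variable {m : ℕ}

theorem character_mem_trigPolynomials (u : Fin m → ℝ) : character u ∈ trigPolynomials m :=
  Algebra.subset_adjoin ⟨u, rfl⟩

theorem const_mem_trigPolynomials (z : ℂ) : (fun _ => z) ∈ trigPolynomials m :=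
  (trigPolynomials m).algebraMap_mem z

theorem character_mul_character (u v : Fin m → ℝ) :
    character u * character v = character (u + v) := by
  ext φ
  simp only [character, Pi.mul_apply, ← Complex.exp_add, ← mul_add, Pi.add_apply, add_mul,
    Finset.sum_add_distrib, Complex.ofReal_add]

theorem star_character (u : Fin m → ℝ) : star (character u) = character (-u) := by
  ext φ
  simp only [character, Pi.star_apply, Pi.neg_apply, neg_mul, Finset.sum_neg_distrib]
  rw [← starRingEnd_apply, ← Complex.exp_conj, map_mul, Complex.conj_I, Complex.conj_ofReal]
  push_cast
  ring_nf

theorem star_mem_trigPolynomials {f : (Fin m → ℝ) → ℂ} (hf : f ∈ trigPolynomials m) :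
    star f ∈ trigPolynomials m := by
  induction hf using Algebra.adjoin_induction with
  | mem f hf =>
    obtain ⟨u, rfl⟩ := hf
    rw [star_character]
    exact character_mem_trigPolynomials _
  | algebraMap z => exact const_mem_trigPolynomials (star z)
  | add f g _ _ hf hg => rw [star_add]; exact add_mem hf hg
  | mul f g _ _ hf hg => rw [star_mul']; exact mul_mem hf hg

/-- Characters are closed under products and contain the constant `1`, so their span is already an
algebra. Linear claims about trigonometric polynomials thus reduce to single characters. -/
theorem mem_span_character {f : (Fin m → ℝ) → ℂ} (hf : f ∈ trigPolynomials m) :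
    f ∈ Submodule.span ℂ (Set.range (character (m := m))) := by
  induction hf using Algebra.adjoin_induction with
  | mem f hf => exact Submodule.subset_span hf
  | algebraMap z =>
    have : algebraMap ℂ ((Fin m → ℝ) → ℂ) z = z • character 0 := by
      ext φ
      simp [character]
    rw [this]
    exact Submodule.smul_mem _ _ (Submodule.subset_span ⟨0, rfl⟩)
  | add f g _ _ hf hg => exact add_mem hf hg
  | mul f g _ _ hf hg =>
    have h := Submodule.mul_mem_mul hf hg
    rw [Submodule.span_mul_span] at h
    refine Submodule.span_mono ?_ h
    rintro _ ⟨_, ⟨u, rfl⟩, _, ⟨v, rfl⟩, rfl⟩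
    exact ⟨u + v, (character_mul_character u v).symm⟩

variable {Ω : Type*} [MeasurableSpace Ω] {P : Measure Ω} {X : Fin m → Ω → ℝ}
  {C : Matrix (Fin m) (Fin m) ℝ}

-- The parameter `b` splits off as a deterministic factor, so differentiating the mean in `b` needs
-- no exchange of limit and integral.
omit [MeasurableSpace Ω] in
theorem character_shift (u d : Fin m → ℝ) (b : ℝ) (ω : Ω) :
    character u (fun j => b * d j + X j ω) =
      Complex.exp (Complex.I * (u ⬝ᵥ d : ℝ) * b) *
        Complex.exp (Complex.I * ((∑ j, u j * X j ω : ℝ) : ℂ)) := by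
  have : ∑ j, u j * (b * d j + X j ω) = (u ⬝ᵥ d) * b + ∑ j, u j * X j ω := by
    simp only [mul_add, Finset.sum_add_distrib, dotProduct, Finset.sum_mul]
    congr 1
    exact Finset.sum_congr rfl fun j _ => by ring
  rw [character, this, ← Complex.exp_add]
  push_cast
  ring_nf

/-- The derivative of the mean of a trigonometric polynomial along a shift `d` of a Gaussian vector
is its mean against the score `c ⬝ X`, where `C c = d`. -/
theorem IsCentredGaussianVector.hasDerivAt_integral_shift (hX : IsCentredGaussianVector P X C)
    (hC : C.IsSymm) {c d : Fin m → ℝ} (hcd : C *ᵥ c = d) (b : ℝ) {f : (Fin m → ℝ) → ℂ}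
    (hf : f ∈ trigPolynomials m) :
    Integrable (fun ω => ((∑ j, c j * X j ω : ℝ) : ℂ) * f (fun j => b * d j + X j ω)) P ∧
    (∀ b : ℝ, Integrable (fun ω => f (fun j => b * d j + X j ω)) P) ∧
    HasDerivAt (fun b : ℝ => ∫ ω, f (fun j => b * d j + X j ω) ∂P)
      (∫ ω, ((∑ j, c j * X j ω : ℝ) : ℂ) * f (fun j => b * d j + X j ω) ∂P) b := by
  have hf' := mem_span_character hf
  clear hf
  induction hf' using Submodule.span_induction with
  | mem f hf =>
    obtain ⟨u, rfl⟩ := hf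
    simp only [character_shift, mul_left_comm]
    refine ⟨(hX.integrable_mul_cexp u c).const_mul _, fun b => (hX.integrable_cexp u).const_mul _,
      ?_⟩
    -- Differentiating the factor in `b` brings down `i u ⬝ d`; Stein's identity produces `i u ⬝ C
    -- c`, the same number since `C c = d`.
    simp only [integral_const_mul, hX.integral_cexp, hX.integral_mul_cexp hC, hcd]
    have h1 : HasDerivAt (fun b : ℝ => Complex.I * (u ⬝ᵥ d : ℝ) * (b : ℂ))
        (Complex.I * (u ⬝ᵥ d : ℝ)) b := by
      simpa using (hasDerivAt_id b).ofReal_comp.const_mul (Complex.I * (u ⬝ᵥ d : ℝ))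
    exact (h1.cexp.mul_const _).congr_deriv (by ring)
  | zero => simp [hasDerivAt_const]
  | add f g _ _ ihf ihg =>
    obtain ⟨f1, f2, f3⟩ := ihf
    obtain ⟨g1, g2, g3⟩ := ihg
    simp only [Pi.add_apply, mul_add]
    refine ⟨f1.add g1, fun b => (f2 b).add (g2 b), ?_⟩
    rw [integral_add f1 g1]
    simp only [fun b => integral_add (f2 b) (g2 b)]
    exact f3.add g3
  | smul z f _ ih =>
    obtain ⟨f1, f2, f3⟩ := ih
    simp only [Pi.smul_apply, smul_eq_mul, mul_left_comm _ z, integral_const_mul]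
    exact ⟨f1.const_mul z, fun b => (f2 b).const_mul z, f3.const_mul z⟩

end

/-! ### Matrices of trigonometric polynomials -/

section

variable {m : ℕ} {n : Type*} [Fintype n]

/-- A matrix whose entries are trigonometric polynomials. -/
def IsTrigMatrix (M : (Fin m → ℝ) → Matrix n n ℂ) : Prop :=
  ∀ x y, (fun φ => M φ x y) ∈ trigPolynomials m

omit [Fintype n] in
theorem isTrigMatrix_const (A : Matrix n n ℂ) : IsTrigMatrix (m := m) fun _ => A :=
  fun _ _ => const_mem_trigPolynomials _

theorem IsTrigMatrix.mul {M M' : (Fin m → ℝ) → Matrix n n ℂ} (h : IsTrigMatrix M)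
    (h' : IsTrigMatrix M') : IsTrigMatrix fun φ => M φ * M' φ := by
  intro x y
  have : (fun φ => (M φ * M' φ) x y) = ∑ j, (fun φ => M φ x j) * fun φ => M' φ j y := by
    ext φ
    simp [mul_apply]
  rw [this]
  exact sum_mem fun j _ => mul_mem (h x j) (h' j y)

omit [Fintype n] in
theorem IsTrigMatrix.conjTranspose {M : (Fin m → ℝ) → Matrix n n ℂ} (h : IsTrigMatrix M) :
    IsTrigMatrix fun φ => (M φ)ᴴ :=
  fun x y => star_mem_trigPolynomials (h y x)

theorem isTrigMatrix_list_prod [DecidableEq n] {q : ℕ} {M : Fin q → (Fin m → ℝ) → Matrix n n ℂ}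
    (h : ∀ k, IsTrigMatrix (M k)) : IsTrigMatrix fun φ => (List.ofFn fun k => M k φ).prod := by
  induction q with
  | zero => simpa using isTrigMatrix_const 1
  | succ q ih =>
    simp only [List.ofFn_succ, List.prod_cons]
    exact (h 0).mul (ih fun k => h k.succ)

end

/-! ### The propagator -/

theorem Jz_eq_diagonal (N : ℕ) :
    Jz N = diagonal fun x => ((1 / 2 * ∑ k, if x k = 0 then 1 else -1 : ℝ) : ℂ) := by
  ext x y
  simp only [Jz, collectiveSpin, onQubit, Matrix.smul_apply, Matrix.sum_apply, of_apply,
    smul_eq_mul]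
  by_cases hxy : x = y
  · subst hxy
    simp only [diagonal_apply_eq, implies_true, if_true]
    push_cast
    congr 1
    refine Finset.sum_congr rfl fun k _ => ?_
    generalize x k = a
    fin_cases a <;> simp [pauliZ]
  · rw [diagonal_apply_ne _ hxy]
    rw [Finset.sum_eq_zero, mul_zero]
    intro k _
    split_ifs with h
    · have hk : x k ≠ y k := fun hk => hxy (funext fun l => by
        by_cases hl : l = k
        · rw [hl, hk]
        · exact h l hl)
      revert hk
      generalize x k = a
      generalize y k = a'
      fin_cases a <;> fin_cases a' <;> simp [pauliZ]
    · rfl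

theorem isHermitian_Jz (N : ℕ) : (Jz N).IsHermitian := by
  rw [Jz_eq_diagonal]
  refine isHermitian_diagonal_of_self_adjoint _ (funext fun x => ?_)
  simp only [Pi.star_apply, RCLike.star_def, Complex.conj_ofReal]

theorem evolve_mem_unitaryGroup {N : ℕ} {A : Op N} (hA : A.IsHermitian) (φ : ℝ) :
    evolve A φ ∈ unitaryGroup (Fin N → Fin 2) ℂ := by
  rw [mem_unitaryGroup_iff', star_eq_conjTranspose, evolve, ← Matrix.exp_conjTranspose]
  have : ((-Complex.I * (φ : ℂ)) • A)ᴴ = -((-Complex.I * (φ : ℂ)) • A) := by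
    rw [conjTranspose_smul, hA.eq, ← neg_smul]
    simp
  generalize (-Complex.I * (φ : ℂ)) • A = B at this ⊢
  rw [this, ← Matrix.exp_add_of_commute (-B) B (Commute.refl B).neg_left, neg_add_cancel,
    NormedSpace.exp_zero]

theorem isTrigMatrix_evolve_Jz {m : ℕ} (N : ℕ) (j : Fin m) :
    IsTrigMatrix fun φ : Fin m → ℝ => evolve (Jz N) (φ j) := by
  intro x y
  simp only [evolve, Jz_eq_diagonal, ← diagonal_smul, Matrix.exp_diagonal]
  by_cases hxy : x = y
  · subst hxy
    simp only [diagonal_apply_eq]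
    simp only [Pi.coe_exp, Pi.smul_apply, smul_eq_mul, ← Complex.exp_eq_exp_ℂ]
    generalize 1 / 2 * ∑ k, (if x k = 0 then (1 : ℝ) else -1) = r
    -- The diagonal entry is `exp (-i r φ j)` with `r` an eigenvalue of `J_z`: a character with
    -- frequency `-r` in coordinate `j` alone.
    convert character_mem_trigPolynomials (Pi.single j (-r)) using 1
    ext φ
    rw [character, Finset.sum_eq_single j]
    · rw [Pi.single_eq_same]
      push_cast
      ring_nf
    · intro k _ hk
      simp [hk]
    · simp
  · simp only [diagonal_apply_ne _ hxy]
    exact const_mem_trigPolynomials 0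

theorem propagator_mem_unitaryGroup {N Q : ℕ} (θ : Fin Q → ℝ) {O : Fin Q → Op N}
    (hO : ∀ k, (O k).IsHermitian) (φ : Fin (Q + 1) → ℝ) :
    propagator θ O φ ∈ unitaryGroup (Fin N → Fin 2) ℂ := by
  refine mul_mem (evolve_mem_unitaryGroup (isHermitian_Jz N) _)
    (Submonoid.list_prod_mem _ fun A hA => ?_)
  obtain ⟨k, rfl⟩ := (List.mem_ofFn' _ _).1 hA
  exact mul_mem (evolve_mem_unitaryGroup (hO _) _) (evolve_mem_unitaryGroup (isHermitian_Jz N) _)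

/-- The pulses do not depend on the phases, so they enter as constant matrices. -/
theorem isTrigMatrix_propagator {N Q : ℕ} (θ : Fin Q → ℝ) (O : Fin Q → Op N) :
    IsTrigMatrix (propagator θ O) :=
  (isTrigMatrix_evolve_Jz N _).mul
    (isTrigMatrix_list_prod fun _ => (isTrigMatrix_const _).mul (isTrigMatrix_evolve_Jz N _))

theorem isDensity_conj_unitary {N : ℕ} {ρ U : Op N} (hρ : IsDensity ρ)
    (hU : U ∈ unitaryGroup (Fin N → Fin 2) ℂ) : IsDensity (U * ρ * Uᴴ) := by
  refine ⟨hρ.1.mul_mul_conjTranspose_same U, ?_⟩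
  rw [mem_unitaryGroup_iff', star_eq_conjTranspose] at hU
  rw [Matrix.trace_mul_comm, ← Matrix.mul_assoc, hU, Matrix.one_mul, hρ.2]

end DephasingMetrology

/-! ### The bound: score, derivative and monotonicity combined. -/

open DephasingMetrology in
theorem theorem1 {Ω : Type*} [MeasurableSpace Ω] (P : Measure Ω) [IsProbabilityMeasure P]
    (Λ : ℝ≥0 → Ω → ℝ) (hΛ : IsGaussianProcess Λ P) (hΛ0 : ∀ s, ∫ ω, Λ s ω ∂P = 0)
    (N Q : ℕ) (t : Fin (Q + 2) → ℝ≥0) (ht0 : t 0 = 0) (ht : StrictMono t)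
    (hSigma : (DephasingMetrology.phaseCovariance P Λ t).PosDef)
    (θ : Fin Q → ℝ) (O : Fin Q → DephasingMetrology.Op N)
    (hO : ∀ k, (O k).IsHermitian) (hOc : ∀ k, DephasingMetrology.IsCollective (O k))
    (ρ₀ : DephasingMetrology.Op N) (hρ₀ : DephasingMetrology.IsDensity ρ₀) (b : ℝ) :
    DephasingMetrology.quantumFisherInformation
        (DephasingMetrology.outputState P Λ t θ O ρ₀) b ≤
      ENNReal.ofReal
        (DephasingMetrology.segmentLength t ⬝ᵥ
          ((DephasingMetrology.phaseCovariance P Λ t)⁻¹ *ᵥ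
            DephasingMetrology.segmentLength t)) := by
  set S := phaseCovariance P Λ t with hS
  set d := segmentLength t with hd
  -- The weights of the Gaussian score `s = c ⬝ λ` for a shift of the mean along `d`.
  set c := S⁻¹ *ᵥ d with hc
  have hcd : S *ᵥ c = d := by
    rw [hc, mulVec_mulVec, mul_nonsing_inv _ ((isUnit_iff_isUnit_det _).1 hSigma.isUnit),
      one_mulVec]
  have hSs : S.IsSymm := by
    have := hSigma.isHermitian
    rwa [IsHermitian, conjTranspose_eq_transpose_of_trivial] at this
  have hX := isCentredGaussianVector_segmentPhase hΛ hΛ0 t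
  set V : (Fin (Q + 1) → ℝ) → Op N :=
    fun φ => propagator θ O φ * ρ₀ * (propagator θ O φ)ᴴ with hV
  have hVt : IsTrigMatrix V :=
    ((isTrigMatrix_propagator θ O).mul (isTrigMatrix_const ρ₀)).mul
      (isTrigMatrix_propagator θ O).conjTranspose
  have hVd : ∀ φ, IsDensity (V φ) := fun φ =>
    isDensity_conj_unitary hρ₀ (propagator_mem_unitaryGroup θ hO φ)
  set s : Ω → ℝ := fun ω => ∑ j, c j * segmentPhase Λ t j ω with hs
  set V' : Ω → Op N := fun ω => V fun j => b * d j + segmentPhase Λ t j ω with hV'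
  have key := fun x y => hX.hasDerivAt_integral_shift hSs hcd b (hVt x y)
  obtain ⟨L, hL, hLeq, hLtr⟩ := exists_lyapunov_trace_le (P := P) (V := V') (s := s)
    (fun x y => (key x y).2.1 b) (fun ω => (hVd _).1) (fun ω => (hVd _).2)
    (fun x y => by simpa [hV', hs] using (key x y).1) (hX.hasGaussianLaw c).memLp_two.integrable_sq
  have hsq : ∫ ω, s ω ^ 2 ∂P = d ⬝ᵥ c := by
    simp only [sq]
    rw [hX.integral_mul c c, hcd, dotProduct_comm]
  have hmean : outputState P Λ t θ O ρ₀ b = matrixMean P V' := rfl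
  have hSLD : IsSLD (outputState P Λ t θ O ρ₀) b L := by
    refine ⟨hL, fun x y => ?_⟩
    rw [hmean, hLeq]
    refine (key x y).2.2.congr_deriv ?_
    simp [matrixMean, hV', hs]
  -- The infimum is bounded by its value at the one operator `L` constructed above.
  refine (iInf₂_le L hSLD).trans (ENNReal.ofReal_le_ofReal ?_)
  rw [hmean, ← hsq]
  exact hLtr
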